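/- All graphs are finite, undirected and simple. For a graph $G=(V,E)$: - A *neighborhood system* $\Sigma$ for $G$ assigns to each vertex $v\in V$ a set $\Sigma(v)$ of neighbors of $v$ in $G$; it is *non-empty* if some $\Sigma(v)$ is non-empty. Put $\rho(\Sigma)=\max_{v\in V}|\Sigma(v)|$. A *$\Sigma$-coloring* is a coloring of the vertices of $G$ (not necessarily proper) in which any two distinct vertices that appear together in some $\Sigma(v)$ receive different colors. Let $\mathrm{ch}(\Sigma)$ be the least $k$ such that, for each assignment of lists of at least $k$ colors to the vertices of $G$, there is a $\Sigma$-coloring in which every vertex receives a color from its list. - A *star coloring* of $G$ is a proper coloring in which every pair of color classes induces a forest of stars (all connected components are stars, a single vertex being a star). The *star choice number* of $G$ is the least $k$ such that, for each assignment of lists of at least $k$ colors to the vertices of $G$, there is a star coloring in which every vertex receives a color from its list. - The *arrangeability* of $G$ is the least $k$ for which there is a linear ordering $\prec$ of $V$ such that for each vertex $v$ there are at most $k$ vertices $x\prec v$ that have a common neighbor $u$ with $v$ such that $v\prec u$. **Theorem.** Let $\mathcal F$ be a class of graphs. The following propositions are equivalent: (i) $\mathcal F$ has bounded star choice number, that is,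 there is a constant $k$ such that every $G\in\mathcal F$ has star choice number at most $k$. (ii) $\mathcal F$ has bounded arrangeability, that is, there is a constant $k$ such that every $G\in\mathcal F$ has arrangeability at most $k$. (iii) There is a constant $C_{\mathcal F}$ such that every $G\in\mathcal F$ and every non-empty neighborhood system $\Sigma$ for $G$ satisfies $\mathrm{ch}(\Sigma)\le C_{\mathcal F}\cdot\rho(\Sigma)$. (iv) There is a function $f_{\mathcal F}$ such that every $G\in\mathcal F$ and every neighborhood system $\Sigma$ for $G$ satisfies $\mathrm{ch}(\Sigma)\le f_{\mathcal F}(\rho(\Sigma))$. (v) The supremum of $\mathrm{ch}(\Sigma)$, over all $G\in\mathcal F$ and all neighborhood systems $\Sigma$ for $G$ with $\rho(\Sigma)=2$, is finite. -/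

import Mathlib

universe u

namespace SigmaColoring

/-- A finite undirected simple graph, bundled with its vertex set. -/
structure FinGraph : Type (u + 1) where
  V : Type u
  finite : Finite V
  graph : SimpleGraph V

attribute [instance] FinGraph.finite

/-- A neighborhood system for `G`: a set `S.nbr v` of neighbors of `v`, for each vertex `v`. -/
structure NbrSystem {V : Type u} (G : SimpleGraph V) where
  nbr : V → Set V
  subset_neighborSet : ∀ v, nbr v ⊆ G.neighborSet v

/-- The neighborhood system is non-empty: some vertex has a non-empty set assigned to it. -/
def NbrSystem.Nonempty {V : Type u} {G : SimpleGraph V} (S : NbrSystem G) : Prop :=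
  ∃ v, (S.nbr v).Nonempty

/-- `ρ(S)`: the maximum size of a set of the neighborhood system
(on a finite vertex set, where the supremum is a maximum; `0` if there are no vertices). -/
noncomputable def NbrSystem.rho {V : Type u} {G : SimpleGraph V} (S : NbrSystem G) : ℕ :=
  ⨆ v, (S.nbr v).ncard

/-- `c` is an `S`-coloring: two distinct vertices appearing together in some set of the system
receive different colors. -/
def NbrSystem.IsColoring {V : Type u} {G : SimpleGraph V} (S : NbrSystem G) (c : V → ℕ) : Prop :=
  ∀ w, ∀ x ∈ S.nbr w, ∀ y ∈ S.nbr w, x ≠ y → c x ≠ c y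

/-- Every assignment of lists of at least `k` colors admits an `S`-coloring from the lists. -/
def NbrSystem.Choosable {V : Type u} {G : SimpleGraph V} (S : NbrSystem G) (k : ℕ) : Prop :=
  ∀ L : V → Finset ℕ, (∀ v, k ≤ (L v).card) → ∃ c : V → ℕ, (∀ v, c v ∈ L v) ∧ S.IsColoring c

/-- `ch(S)`: the least `k` such that every assignment of lists of at least `k` colors admits an
`S`-coloring from the lists. -/
noncomputable def NbrSystem.ch {V : Type u} {G : SimpleGraph V} (S : NbrSystem G) : ℕ :=
  sInf {k | S.Choosable k}

/-- Every connected component is a star (a single vertex counts as a star). -/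
def IsStarForest {W : Type u} (H : SimpleGraph W) : Prop :=
  ∀ C : H.ConnectedComponent, ∃ r : C, C.toSimpleGraph = SimpleGraph.starGraph r

/-- A star coloring: a proper coloring in which every pair of color classes induces a forest of
stars. -/
def IsStarColoring {V : Type u} (G : SimpleGraph V) (c : V → ℕ) : Prop :=
  (∀ x y, G.Adj x y → c x ≠ c y) ∧
    ∀ a b : ℕ, a ≠ b → IsStarForest (G.induce {v | c v = a ∨ c v = b})

/-- Every assignment of lists of at least `k` colors admits a star coloring from the lists. -/
def StarChoosable {V : Type u} (G : SimpleGraph V) (k : ℕ) : Prop :=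
  ∀ L : V → Finset ℕ, (∀ v, k ≤ (L v).card) →
    ∃ c : V → ℕ, (∀ v, c v ∈ L v) ∧ IsStarColoring G c

/-- The star choice number of `G`. -/
noncomputable def starChoiceNumber {V : Type u} (G : SimpleGraph V) : ℕ :=
  sInf {k | StarChoosable G k}

/-- Some linear ordering of the vertices is such that, for each vertex `v`, at most `k` vertices
smaller than `v` have with `v` a common neighbor that is larger than `v`. -/
def Arrangeable {V : Type u} (G : SimpleGraph V) (k : ℕ) : Prop :=
  ∃ _ : LinearOrder V, ∀ v : V,
    {x : V | x < v ∧ ∃ y, G.Adj v y ∧ G.Adj x y ∧ v < y}.ncard ≤ k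

/-- The arrangeability of `G`. -/
noncomputable def arrangeability {V : Type u} (G : SimpleGraph V) : ℕ :=
  sInf {k | Arrangeable G k}

/-! On finite graphs the minima above are taken over non-empty sets. -/

theorem exists_injective_choice {V : Type u} [Finite V] (L : V → Finset ℕ)
    (hL : ∀ v, Nat.card V ≤ (L v).card) :
    ∃ c : V → ℕ, (∀ v, c v ∈ L v) ∧ Function.Injective c := by
  classical
  have := Fintype.ofFinite V
  obtain ⟨c, hc, h⟩ := (Finset.all_card_le_biUnion_card_iff_exists_injective L).1 (by
    intro s
    rcases s.eq_empty_or_nonempty with rfl | ⟨v, hv⟩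
    · simp
    · calc s.card ≤ Nat.card V := by
            rw [Nat.card_eq_fintype_card]; exact s.card_le_univ
        _ ≤ (L v).card := hL v
        _ ≤ _ := Finset.card_le_card (Finset.subset_biUnion_of_mem L hv))
  exact ⟨c, h, hc⟩

theorem NbrSystem.choosable_card {V : Type u} [Finite V] {G : SimpleGraph V} (S : NbrSystem G) :
    S.Choosable (Nat.card V) := fun L hL => by
  obtain ⟨c, h, hc⟩ := exists_injective_choice L hL
  exact ⟨c, h, fun _ _ _ _ _ hxy => hc.ne hxy⟩

theorem starChoosable_card {V : Type u} [Finite V] (G : SimpleGraph V) :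
    StarChoosable G (Nat.card V) := fun L hL => by
  obtain ⟨c, h, hc⟩ := exists_injective_choice L hL
  refine ⟨c, h, fun x y hxy => hc.ne hxy.ne, fun a b _ C => ?_⟩
  obtain ⟨r, hr⟩ := C.nonempty_supp
  have key : ∀ x y : {v | c v = a ∨ c v = b}, x ≠ y → x = r ∨ y = r := by
    intro x y hxy
    have hne : c x ≠ c y := fun e => hxy (Subtype.ext (hc e))
    have hx : c x = a ∨ c x = b := x.2
    have hy : c y = a ∨ c y = b := y.2
    have hr' : c r = a ∨ c r = b := r.2
    have h' : c x = c r ∨ c y = c r := by omega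
    exact h'.imp (fun e => Subtype.ext (hc e)) (fun e => Subtype.ext (hc e))
  have adj : ∀ y : C, y ≠ ⟨r, hr⟩ → C.toSimpleGraph.Adj ⟨r, hr⟩ y := by
    intro y hy
    obtain ⟨p⟩ := C.connected_toSimpleGraph.preconnected ⟨r, hr⟩ y
    cases p with
    | nil => exact absurd rfl hy
    | @cons _ z _ hz _ =>
      by_cases hzy : z = y
      · exact hzy ▸ hz
      · rcases key z y (fun e => hzy (Subtype.ext e)) with e | e
        · exact absurd (Subtype.ext e.symm) hz.ne
        · exact absurd (Subtype.ext e) hy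
  refine ⟨⟨r, hr⟩, ?_⟩
  ext x y
  rw [SimpleGraph.starGraph_adj]
  refine ⟨fun h => ⟨h.ne, ?_⟩, ?_⟩
  · exact (key x y (fun e => h.ne (Subtype.ext e))).imp (fun e => Subtype.ext e)
      (fun e => Subtype.ext e)
  · rintro ⟨hne, rfl | rfl⟩
    · exact adj y hne.symm
    · exact (adj x hne).symm

theorem arrangeable_card {V : Type u} [Finite V] (G : SimpleGraph V) :
    Arrangeable G (Nat.card V) := by
  classical
  exact ⟨linearOrderOfSTO WellOrderingRel, fun _ => Set.ncard_le_card _⟩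

end SigmaColoring

/-! An arrangement bounds the number of earlier conflicts of each vertex, so coloring greedily along
it gives (i) and (iii) (`Arrangeable.starChoosable`, `Arrangeable.choosable`). The implications
(iii) ⇒ (iv) ⇒ (v) are formal.

The way back to (ii) passes through pair graphs: each vertex of `G` picks at most one pair of its
neighbors, and the picked pairs are the edges. If some pair graph has a subgraph of large minimum
degree, a counting argument in the style of Alon (`exists_lists_of_large_degree`) produces lists
from which every coloring has a vertex with many pair-neighbors of its own color. This defeats
colorings of systems with `ρ = 2` and, after pigeonholing the colors of the middle vertices, star
colorings. Hence (i) and (v) each make all pair graphs of bounded degeneracy (`PairDegenerate`).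

Such a bound also makes `G` degenerate (`exists_isDegenerate_of_pairDegenerate`). The arrangement is
then built from its largest vertex down, an averaging argument supplying each next vertex
(`exists_next_vertex`). -/

namespace SigmaColoring

open Finset

/-! ### Counting labellings -/

section Counting

theorem card_restricted_functions_le {V T : Type*} [Fintype V] [Fintype T] [DecidableEq V]
    (N : Finset V) (Q : V → T → Prop) [∀ u, DecidablePred (Q u)] (r : ℕ)
    (hQ : ∀ u ∈ N, #{t | Q u t} ≤ r) [DecidablePred fun χ : V → T => ∀ u ∈ N, Q u (χ u)] :
    #{χ : V → T | ∀ u ∈ N, Q u (χ u)} ≤ r ^ #N * Fintype.card T ^ (Fintype.card V - #N) := by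
  have h : ({χ : V → T | ∀ u ∈ N, Q u (χ u)} : Finset (V → T)) ⊆
      Fintype.piFinset fun u => if u ∈ N then ({t | Q u t} : Finset T) else univ := by
    intro χ hχ
    simp only [mem_filter, mem_univ, true_and] at hχ
    simp only [Fintype.mem_piFinset]
    intro u
    split_ifs with hu
    · simpa using hχ u hu
    · simp
  refine (card_le_card h).trans ?_
  rw [Fintype.card_piFinset, ← prod_mul_prod_compl N, ← card_compl]
  refine Nat.mul_le_mul ?_ ?_
  · refine prod_le_pow_card _ _ _ fun u hu => ?_
    rw [if_pos hu]
    exact hQ u hu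
  · refine prod_le_pow_card _ _ _ fun u hu => ?_
    rw [if_neg (mem_compl.1 hu)]
    exact le_of_eq rfl

theorem exists_mul_pred_pow_lt_pow (a q : ℕ) (hq : 0 < q) : ∃ d : ℕ, a * (q - 1) ^ d < q ^ d := by
  have hq' : (0 : ℝ) < q := by exact_mod_cast hq
  have hlt : ((q - 1 : ℕ) : ℝ) / q < 1 := by
    rw [div_lt_one hq']
    exact_mod_cast Nat.sub_lt hq one_pos
  obtain ⟨d, hd⟩ := exists_pow_lt_of_lt_one (show (0 : ℝ) < 1 / (a + 1) by positivity) hlt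
  refine ⟨d, ?_⟩
  rw [div_pow, div_lt_div_iff₀ (by positivity) (by positivity)] at hd
  have h : ((a * (q - 1) ^ d : ℕ) : ℝ) < (q ^ d : ℕ) := by
    push_cast
    nlinarith [pow_nonneg (Nat.cast_nonneg (α := ℝ) (q - 1)) d]
  exact_mod_cast h

/-- If all neighborhoods are large, then some labelling of the vertices is such that most vertices
see all labels. -/
theorem exists_rich_labelling (T : Type) [Fintype T] [Nonempty T] :
    ∃ d : ℕ, ∀ {V : Type u} [Fintype V] (N : V → Finset V) (U : Finset V),
      (∀ v ∈ U, d ≤ #(N v)) →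
        ∃ χ : V → T, ∀ B : Finset V, B ⊆ U → (∀ v ∈ B, ∃ t, ∀ u ∈ N v, χ u ≠ t) →
          4 * #B ≤ #U := by
  classical
  set q := Fintype.card T with hqdef
  have hq : 0 < q := Fintype.card_pos
  obtain ⟨d, hd⟩ := exists_mul_pred_pow_lt_pow (4 * q) q hq
  refine ⟨d, fun {V} _ N U hN => ?_⟩
  by_contra! hcon
  choose B hBU hB hlt using hcon
  set n := Fintype.card V
  -- Union bound over the `q` labels: at most a fraction `q (1 - 1/q)^d < 1/4` of all labellings
  -- miss some label around `v`. Double counting pairs of a labelling and a failing vertex then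
  -- contradicts `hlt`.
  have hmiss : ∀ v ∈ U, 4 * #{χ : V → T | ∃ t, ∀ u ∈ N v, χ u ≠ t} ≤ q ^ n := by
    intro v hv
    have hsub : ({χ : V → T | ∃ t, ∀ u ∈ N v, χ u ≠ t} : Finset (V → T)) ⊆
        (univ : Finset T).biUnion fun t => {χ : V → T | ∀ u ∈ N v, χ u ≠ t} := by
      intro χ hχ
      simpa using hχ
    have hone : ∀ t : T, #{χ : V → T | ∀ u ∈ N v, χ u ≠ t} ≤
        (q - 1) ^ #(N v) * q ^ (n - #(N v)) := by
      intro t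
      refine card_restricted_functions_le (N v) (fun _ s => s ≠ t) (q - 1) fun u _ => ?_
      rw [filter_ne', card_erase_of_mem (mem_univ _), card_univ]
    have hall : #{χ : V → T | ∃ t, ∀ u ∈ N v, χ u ≠ t} ≤
        q * ((q - 1) ^ #(N v) * q ^ (n - #(N v))) := by
      refine (card_le_card hsub).trans (card_biUnion_le.trans ?_)
      refine (sum_le_card_nsmul _ _ _ fun t _ => hone t).trans ?_
      simp [hqdef, card_univ]
    have hdeg := hN v hv
    have hcard : #(N v) ≤ n := card_le_univ _
    calc 4 * #{χ : V → T | ∃ t, ∀ u ∈ N v, χ u ≠ t}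
        ≤ 4 * (q * ((q - 1) ^ #(N v) * q ^ (n - #(N v)))) := Nat.mul_le_mul_left _ hall
      _ = (4 * q * (q - 1) ^ d) * (q - 1) ^ (#(N v) - d) * q ^ (n - #(N v)) := by
          conv_lhs => rw [← Nat.add_sub_cancel' hdeg, pow_add]
          rw [Nat.add_sub_cancel' hdeg]; ring
      _ ≤ q ^ d * q ^ (#(N v) - d) * q ^ (n - #(N v)) := by
          gcongr
          omega
      _ = q ^ n := by
          rw [← pow_add, ← pow_add]
          congr 1
          omega
  have hcount : ∑ χ : V → T, #(B χ) ≤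
      ∑ v ∈ U, #{χ : V → T | ∃ t, ∀ u ∈ N v, χ u ≠ t} := by
    have h1 : ∀ χ : V → T, #(B χ) ≤ #{v ∈ U | ∃ t, ∀ u ∈ N v, χ u ≠ t} := fun χ =>
      card_le_card fun v hv => mem_filter.2 ⟨hBU χ hv, hB χ v hv⟩
    refine (sum_le_sum fun χ _ => h1 χ).trans (le_of_eq ?_)
    simp only [card_filter]
    exact sum_comm
  have h2 : ∑ χ : V → T, #U < ∑ χ : V → T, 4 * #(B χ) :=
    sum_lt_sum_of_nonempty ⟨fun _ => Classical.arbitrary T, mem_univ _⟩ fun χ _ => hlt χ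
  have h3 : ∑ v ∈ U, 4 * #{χ : V → T | ∃ t, ∀ u ∈ N v, χ u ≠ t} ≤ ∑ v ∈ U, q ^ n :=
    sum_le_sum hmiss
  rw [← mul_sum] at h2 h3
  have h4 : ∑ χ : V → T, #U = ∑ v ∈ U, q ^ n := by
    simp [hqdef, n, mul_comm]
  omega

/-- If all neighborhoods are large, there are a labelled set `A` and a much larger set `B`
such that all vertices of `B` see all labels in `A`. -/
theorem exists_unbalanced_pair (T : Type) [Fintype T] [Nonempty T] (M : ℕ) :
    ∃ d : ℕ, ∀ {V : Type u} [Fintype V] (N : V → Finset V) (U : Finset V), U.Nonempty →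
      (∀ v ∈ U, d ≤ #(N v) ∧ N v ⊆ U) →
        ∃ (A B : Finset V) (χ : V → T), A ⊆ U ∧ B ⊆ U ∧ Disjoint A B ∧ B.Nonempty ∧
          M * #A ≤ #B ∧ ∀ b ∈ B, ∀ t, ∃ u ∈ N b, u ∈ A ∧ χ u = t := by
  classical
  obtain ⟨d, hd⟩ := exists_rich_labelling.{u} (Fin (2 * M + 4) × T)
  refine ⟨d, fun {V} _ N U hU hN => ?_⟩
  obtain ⟨χ, hχ⟩ := hd N U fun v hv => (hN v hv).1
  -- The rarest first coordinate gives `A`, of size at most `#U / (2M + 4) ≤ #U / 4`. At most `#U /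
  -- 4` vertices miss a label, so at least `#U / 2 ≥ M * #A` vertices are left for `B`.
  obtain ⟨j, -, hj⟩ : ∃ j ∈ (univ : Finset (Fin (2 * M + 4))),
      (2 * M + 4) * #{u ∈ U | (χ u).1 = j} ≤ #U := by
    by_contra! h
    have h1 := sum_lt_sum_of_nonempty (univ_nonempty (α := Fin (2 * M + 4))) h
    rw [← mul_sum, ← card_eq_sum_card_fiberwise (fun _ _ => mem_univ _)] at h1
    simp at h1
  set A : Finset V := {u ∈ U | (χ u).1 = j}
  set X : Finset V := {v ∈ U | ∃ t, ∀ u ∈ N v, χ u ≠ t}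
  have hX := hχ X (filter_subset _ _) fun v hv => (mem_filter.1 hv).2
  have hsize : #U ≤ #(U \ (A ∪ X)) + (#A + #X) :=
    (card_le_card_sdiff_add_card (s := U) (t := A ∪ X)).trans
      (Nat.add_le_add_left (card_union_le _ _) _)
  have hUpos := hU.card_pos
  have hexp : (2 * M + 4) * #A = 2 * (M * #A) + 4 * #A := by ring
  refine ⟨A, U \ (A ∪ X), fun v => (χ v).2, filter_subset _ _, sdiff_subset, ?_, ?_, ?_, ?_⟩
  · exact disjoint_sdiff.mono_left subset_union_left
  · rw [← card_pos]
    omega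
  · omega
  · intro b hb t
    simp only [mem_sdiff, mem_union, not_or] at hb
    have hbX : ¬ ∃ s, ∀ u ∈ N b, χ u ≠ s := fun h => hb.2.2 (mem_filter.2 ⟨hb.1, h⟩)
    push Not at hbX
    obtain ⟨u, hu, hut⟩ := hbX (j, t)
    exact ⟨u, hu, mem_filter.2 ⟨(hN b hb.1).2 hu, by rw [hut]⟩, congrArg Prod.snd hut⟩

end Counting

/-! ### Lists defeating all colorings with few monochromatic edges -/

/-- In graphs of large minimum degree, some lists of size `k` are such that all colorings from the
lists have a vertex with more than `t` neighbors of its own color. -/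
theorem exists_lists_of_large_degree (k t : ℕ) (hk : 0 < k) :
    ∃ d : ℕ, 0 < d ∧ ∀ {V : Type u} [Fintype V] (N : V → Finset V) (U : Finset V), U.Nonempty →
      (∀ v ∈ U, d ≤ #(N v) ∧ N v ⊆ U) →
        ∃ L : V → Finset ℕ, (∀ v, L v ⊆ range (2 * k) ∧ #(L v) = k) ∧
          ∀ c : V → ℕ, (∀ v, c v ∈ L v) → ∃ v ∈ U, t < #{u ∈ N v | c u = c v} := by
  classical
  set P : Finset (Finset ℕ) := powersetCard k (range (2 * k))
  have hPne : P.Nonempty := by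
    refine ⟨range k, mem_powersetCard.2 ⟨?_, card_range k⟩⟩
    exact range_subset_range.2 (by omega)
  have : Nonempty P := hPne.to_subtype
  obtain ⟨M, hM⟩ := exists_mul_pred_pow_lt_pow k #P hPne.card_pos
  -- The first component of a label serves as the list of a vertex of `A`; the second makes every
  -- vertex of `B` see each possible list `k * t + 1` times. `M` is such that `#B ≥ M * #A` beats
  -- the `k ^ #A` colorings of `A` in the union bound.
  obtain ⟨d, hd⟩ := exists_unbalanced_pair.{u} (P × Fin (k * t + 1)) M
  refine ⟨d + 1, d.succ_pos, fun {V} _ N U hU hN => ?_⟩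
  obtain ⟨A, B, χ, hAU, hBU, hAB, hBne, hMAB, hsee⟩ :=
    hd N U hU fun v hv => ⟨(Nat.le_succ d).trans (hN v hv).1, (hN v hv).2⟩
  have hAne : A.Nonempty := by
    obtain ⟨b, hb⟩ := hBne
    obtain ⟨u, -, hu, -⟩ := hsee b hb (Classical.arbitrary _)
    exact ⟨u, hu⟩
  let often (f : V → ℕ) (b : V) : Finset ℕ :=
    {i ∈ range (2 * k) | t < #{u ∈ N b | u ∈ A ∧ f u = i}}
  -- Colorings of `A` from its lists, extended by 0 so that there are exactly `k ^ #A` of them.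
  let F : Finset (V → ℕ) := Fintype.piFinset fun a => if a ∈ A then ((χ a).1 : Finset ℕ) else {0}
  have hFcard : #F = k ^ #A := by
    rw [Fintype.card_piFinset, ← prod_mul_prod_compl A]
    rw [prod_congr rfl (g := fun _ => k), prod_congr (s₁ := Aᶜ) rfl (g := fun _ => 1)]
    · simp
    · intro a ha
      simp [mem_compl.1 ha]
    · intro a ha
      rw [if_pos ha]
      exact (mem_powersetCard.1 (χ a).1.2).2
  have hoften : ∀ f ∈ F, ∀ b ∈ B, ∃ Q : P, (Q : Finset ℕ) ⊆ often f b := by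
    intro f hf b hb
    -- Otherwise `k` rare colors form a list `Q`; among the `k * t + 1` neighbors of `b` with list
    -- `Q`, some color of `Q` occurs more than `t` times.
    have hsmall : #(range (2 * k) \ often f b) < k := by
      by_contra! hge
      obtain ⟨Q, hQsub, hQcard⟩ := exists_subset_card_eq hge
      have hQP : Q ∈ P := mem_powersetCard.2 ⟨hQsub.trans sdiff_subset, hQcard⟩
      choose u huN huA hu using fun i : Fin (k * t + 1) => hsee b hb (⟨Q, hQP⟩, i)
      have hinj : Function.Injective u := fun i j hij => by
        have h := (hu i).symm.trans ((congrArg χ hij).trans (hu j))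
        exact (Prod.mk.inj h).2
      have hfu : ∀ i, f (u i) ∈ Q := by
        intro i
        have h := Fintype.mem_piFinset.1 hf (u i)
        rw [if_pos (huA i), hu i] at h
        exact h
      obtain ⟨p, hpQ, hp⟩ := exists_lt_card_fiber_of_mul_lt_card_of_maps_to
        (s := (univ : Finset (Fin (k * t + 1)))) (t := Q) (f := fun i => f (u i)) (n := t)
        (fun i _ => hfu i) (by simp [hQcard])
      have hpQ' := mem_sdiff.1 (hQsub hpQ)
      refine hpQ'.2 (mem_filter.2 ⟨hpQ'.1, hp.trans_le ?_⟩)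
      refine card_le_card_of_injOn u (fun i hi => ?_) hinj.injOn
      have hi' := (mem_filter.1 hi).2
      exact mem_filter.2 ⟨huN i, huA i, hi'⟩
    have hle : #(range (2 * k)) ≤ #(range (2 * k) \ often f b) + #(often f b) :=
      card_le_card_sdiff_add_card
    rw [card_range] at hle
    obtain ⟨Q, hQsub, hQcard⟩ := exists_subset_card_eq (show k ≤ #(often f b) by omega)
    exact ⟨⟨Q, mem_powersetCard.2 ⟨hQsub.trans (filter_subset _ _), hQcard⟩⟩, hQsub⟩
  have hbad : ∀ f ∈ F, #{l : V → P | ∀ b ∈ B, ¬ (l b : Finset ℕ) ⊆ often f b} ≤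
      (#P - 1) ^ #B * #P ^ (Fintype.card V - #B) := by
    intro f hf
    have h := card_restricted_functions_le (T := P) B
      (fun b l => ¬ (l : Finset ℕ) ⊆ often f b) (#P - 1) fun b hb => by
        obtain ⟨Q, hQ⟩ := hoften f hf b hb
        have hss : ({l : P | ¬ (l : Finset ℕ) ⊆ often f b} : Finset P) ⊆ univ.erase Q := by
          intro l hl
          refine mem_erase.2 ⟨?_, mem_univ _⟩
          rintro rfl
          exact (mem_filter.1 hl).2 hQ
        refine (card_le_card hss).trans ?_
        rw [card_erase_of_mem (mem_univ _), card_univ, Fintype.card_coe]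
    rwa [Fintype.card_coe] at h
  have hpow : k ^ #A * (#P - 1) ^ #B < #P ^ #B := by
    obtain ⟨e, he⟩ := Nat.exists_eq_add_of_le hMAB
    rw [he, pow_add, pow_add, pow_mul, pow_mul, ← mul_assoc, ← mul_pow]
    refine Nat.mul_lt_mul_of_lt_of_le (Nat.pow_lt_pow_left hM hAne.card_pos.ne') ?_ ?_
    · exact Nat.pow_le_pow_left (Nat.sub_le _ _) _
    · exact pow_pos hPne.card_pos _
  -- For a fixed `f`, a random list at `b` avoids containment in `often f b` with probability at
  -- most `1 - 1/#P`, independently over `B`. By `hpow` the union bound over `F` leaves a good `l`.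
  obtain ⟨l, hl⟩ : ∃ l : V → P, ∀ f ∈ F, ∃ b ∈ B, (l b : Finset ℕ) ⊆ often f b := by
    by_contra! hcon
    have hcov : (univ : Finset (V → P)) ⊆
        F.biUnion fun f => {l : V → P | ∀ b ∈ B, ¬ (l b : Finset ℕ) ⊆ often f b} := by
      intro l _
      obtain ⟨f, hf, h⟩ := hcon l
      exact mem_biUnion.2 ⟨f, hf, mem_filter.2 ⟨mem_univ _, h⟩⟩
    have h1 := (card_le_card hcov).trans
      (card_biUnion_le.trans (sum_le_card_nsmul _ _ _ hbad))
    rw [card_univ, Fintype.card_fun, Fintype.card_coe, hFcard, smul_eq_mul, ← mul_assoc] at h1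
    have h2 : #P ^ Fintype.card V = #P ^ #B * #P ^ (Fintype.card V - #B) := by
      rw [← pow_add, Nat.add_sub_cancel' (card_le_univ B)]
    rw [h2] at h1
    exact absurd (Nat.le_of_mul_le_mul_right h1 (pow_pos hPne.card_pos _)) (not_le.2 hpow)
  refine ⟨fun v => if v ∈ A then (χ v).1 else l v, fun v => ?_, fun c hc => ?_⟩
  · dsimp only
    split_ifs
    · exact mem_powersetCard.1 (χ v).1.2
    · exact mem_powersetCard.1 (l v).2
  · obtain ⟨b, hb, hlb⟩ := hl (fun v => if v ∈ A then c v else 0) (by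
      refine Fintype.mem_piFinset.2 fun a => ?_
      have h := hc a
      dsimp only at h ⊢
      split_ifs with ha
      · rwa [if_pos ha] at h
      · simp)
    have hcb := hc b
    dsimp only at hcb
    rw [if_neg (disjoint_right.1 hAB hb)] at hcb
    refine ⟨b, hBU hb, (mem_filter.1 (hlb hcb)).2.trans_le (card_le_card fun u hu => ?_)⟩
    obtain ⟨huN, huA, hu⟩ := mem_filter.1 hu
    dsimp only at hu
    rw [if_pos huA] at hu
    exact mem_filter.2 ⟨huN, hu⟩

/-! ### Star colorings and bicolored paths -/

section StarColoring

variable {V : Type u} {G : SimpleGraph V}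

/-- The center of the component would lie on both of the disjoint edges `pr` and `st`. -/
theorem IsStarForest.no_path {W : Type u} {H : SimpleGraph W} (h : IsStarForest H) {p r s t : W}
    (hpr : H.Adj p r) (hrs : H.Adj r s) (hst : H.Adj s t) (hps : p ≠ s) (hrt : r ≠ t)
    (hpt : p ≠ t) : False := by
  let C := H.connectedComponentMk r
  have hr : r ∈ C := rfl
  have hp : p ∈ C := SimpleGraph.ConnectedComponent.sound hpr.reachable
  have hs : s ∈ C := SimpleGraph.ConnectedComponent.sound hrs.symm.reachable
  have ht : t ∈ C :=
    SimpleGraph.ConnectedComponent.sound (hst.symm.reachable.trans hrs.symm.reachable)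
  obtain ⟨z, hz⟩ := h C
  have key : ∀ x y : C, H.Adj x y → x = z ∨ y = z := by
    intro x y hxy
    have hxy' : C.toSimpleGraph.Adj x y := hxy
    rw [hz, SimpleGraph.starGraph_adj] at hxy'
    exact hxy'.2
  have h1 := key ⟨p, hp⟩ ⟨r, hr⟩ hpr
  have h2 := key ⟨s, hs⟩ ⟨t, ht⟩ hst
  simp only [Subtype.ext_iff] at h1 h2
  rcases h1 with h1 | h1 <;> rcases h2 with h2 | h2
  · exact hps (h1.trans h2.symm)
  · exact hpt (h1.trans h2.symm)
  · exact hrs.ne (h1.trans h2.symm)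
  · exact hrt (h1.trans h2.symm)

theorem IsStarColoring.no_bicolored_path {c : V → ℕ} (h : IsStarColoring G c) {p r s t : V}
    (hpr : G.Adj p r) (hrs : G.Adj r s) (hst : G.Adj s t) (hps : p ≠ s) (hrt : r ≠ t)
    (hcp : c p = c s) (hcr : c r = c t) : False := by
  have hne := h.1 r s hrs
  have hpt : p ≠ t := fun e => hne (by rw [hcr, ← hcp, e])
  have hf := h.2 (c r) (c s) hne
  exact hf.no_path (p := ⟨p, Or.inr hcp⟩) (r := ⟨r, Or.inl rfl⟩) (s := ⟨s, Or.inr rfl⟩)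
    (t := ⟨t, Or.inl hcr.symm⟩) hpr hrs hst (fun e => hps (congrArg Subtype.val e))
    (fun e => hrt (congrArg Subtype.val e)) (fun e => hpt (congrArg Subtype.val e))

theorem isStarForest_of_no_path {W : Type u} {H : SimpleGraph W}
    (hpath : ∀ p r s t, H.Adj p r → H.Adj r s → H.Adj s t → p ≠ s → r ≠ t → False) :
    IsStarForest H := by
  intro C
  -- The center is a vertex with two neighbors if there is one, and any vertex otherwise.
  obtain ⟨r, hr⟩ : ∃ r : C, ∀ s t, H.Adj r s → H.Adj s t → t ≠ r → False := by
    by_cases h : ∃ r : C, ∃ p q, H.Adj r p ∧ H.Adj r q ∧ p ≠ q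
    · obtain ⟨r, p, q, hp, hq, hpq⟩ := h
      refine ⟨r, fun s t hrs hst htr => ?_⟩
      by_cases hps : p = s
      · exact hpath q r s t hq.symm hrs hst (fun e => hpq (hps.trans e.symm)) htr.symm
      · exact hpath p r s t hp.symm hrs hst hps htr.symm
    · obtain ⟨r, hr⟩ := C.nonempty_supp
      refine ⟨⟨r, hr⟩, fun s t hrs hst htr => h ?_⟩
      have hs : s ∈ C.supp := C.mem_supp_of_adj_mem_supp hr hrs
      exact ⟨⟨s, hs⟩, r, t, hrs.symm, hst, htr.symm⟩
  have hnear : ∀ y : C, y = r ∨ C.toSimpleGraph.Adj r y := by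
    intro y
    obtain ⟨p⟩ := C.connected_toSimpleGraph.preconnected y r
    induction p with
    | nil => exact Or.inl rfl
    | @cons x y z hxy p ih =>
      rcases ih hr with rfl | hy
      · exact Or.inr hxy.symm
      · by_cases hx : x = z
        · exact Or.inl hx
        · exact (hr y x hy hxy.symm fun e => hx (Subtype.ext e)).elim
  refine ⟨r, ?_⟩
  ext x y
  rw [SimpleGraph.starGraph_adj]
  constructor
  · intro hxy
    refine ⟨hxy.ne, ?_⟩
    rcases hnear x with hx | hx
    · exact Or.inl hx
    · by_cases hy : y = r
      · exact Or.inr hy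
      · exact (hr x y hx hxy fun e => hy (Subtype.ext e)).elim
  · rintro ⟨hne, rfl | rfl⟩
    · exact (hnear y).resolve_left hne.symm
    · exact ((hnear x).resolve_left hne).symm

theorem isStarColoring_of_no_bicolored_path {c : V → ℕ} (hproper : ∀ x y, G.Adj x y → c x ≠ c y)
    (hpath : ∀ p r s t, G.Adj p r → G.Adj r s → G.Adj s t → p ≠ s → r ≠ t →
      c p = c s → c r = c t → False) : IsStarColoring G c := by
  refine ⟨hproper, fun a b hab => isStarForest_of_no_path ?_⟩
  rintro ⟨p, hp⟩ ⟨r, hr⟩ ⟨s, hs⟩ ⟨t, ht⟩ hpr hrs hst hps hrt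
  have h1 := hproper p r hpr
  have h2 := hproper r s hrs
  have h3 := hproper s t hst
  simp only [Set.mem_ofPred_eq] at hp hr hs ht
  exact hpath p r s t hpr hrs hst (fun e => hps (Subtype.ext e)) (fun e => hrt (Subtype.ext e))
    (by omega) (by omega)

end StarColoring

/-! ### Greedy coloring along an arrangement -/

section Greedy

theorem exists_greedy_coloring {V : Type u} [Finite V] [LinearOrder V] (R : V → V → Prop) (k : ℕ)
    (hR : ∀ v, {x | x < v ∧ R v x}.ncard < k) (L : V → Finset ℕ) (hL : ∀ v, k ≤ #(L v)) :
    ∃ c : V → ℕ, (∀ v, c v ∈ L v) ∧ ∀ v x, x < v → R v x → c v ≠ c x := by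
  classical
  have := Fintype.ofFinite V
  have hchoice : ∀ (v : V) (f : V → ℕ), ∃ i ∈ L v, ∀ x, x < v → R v x → i ≠ f x := by
    intro v f
    have hlt : #(({x | x < v ∧ R v x} : Finset V).image f) < #(L v) := by
      refine card_image_le.trans_lt (lt_of_lt_of_le ?_ (hL v))
      have h := hR v
      rwa [Set.ncard_eq_toFinset_card', Set.toFinset_ofPred] at h
    obtain ⟨i, hi, hi'⟩ := exists_mem_notMem_of_card_lt_card hlt
    exact ⟨i, hi, fun x hx hRx e => hi' (mem_image.2 ⟨x, by simp [hx, hRx], e.symm⟩)⟩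
  choose g hgL hg using hchoice
  -- The value 0 at `x ≥ v` is a dummy: `hg` only speaks of `x < v`.
  let c : V → ℕ := (wellFounded_lt (α := V)).fix fun v ih =>
    g v fun x => if hx : x < v then ih x hx else 0
  have hc : ∀ v, c v = g v fun x => if x < v then c x else 0 := by
    intro v
    have h := (wellFounded_lt (α := V)).fix_eq
      (fun v (ih : ∀ x, x < v → ℕ) => g v fun x => if hx : x < v then ih x hx else 0) v
    simpa using h
  refine ⟨c, fun v => by rw [hc]; exact hgL _ _, fun v x hx hRx => ?_⟩
  have h := hg v (fun x => if x < v then c x else 0) x hx hRx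
  rw [if_pos hx] at h
  rwa [hc]

variable {V : Type u} [Finite V] [LinearOrder V] {G : SimpleGraph V} {k : ℕ}

/-- If `w` is the largest lower neighbor of `v`, every other one lies below `w` and shares with `w`
the neighbor `v`, which is above `w`. -/
theorem ncard_lower_neighbors_le
    (h : ∀ v : V, {x : V | x < v ∧ ∃ y, G.Adj v y ∧ G.Adj x y ∧ v < y}.ncard ≤ k) (v : V) :
    {x | x < v ∧ G.Adj v x}.ncard ≤ k + 1 := by
  rcases Set.eq_empty_or_nonempty {x | x < v ∧ G.Adj v x} with h0 | hne
  · simp [h0]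
  · obtain ⟨w, hw, hmax⟩ := Set.exists_max_image _ id (Set.toFinite _) hne
    have hsub : {x | x < v ∧ G.Adj v x} ⊆
        insert w {x : V | x < w ∧ ∃ y, G.Adj w y ∧ G.Adj x y ∧ w < y} := by
      intro x hx
      rcases (hmax x hx).eq_or_lt with e | hlt
      · exact Or.inl e
      · exact Or.inr ⟨hlt, v, hw.2.symm, hx.2.symm, hw.1⟩
    exact (Set.ncard_le_ncard hsub (Set.toFinite _)).trans
      ((Set.ncard_insert_le _ _).trans (Nat.add_le_add_right (h w) 1))

theorem ncard_lower_union_le (N : V → Set V) (m : ℕ) (v : V)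
    (h : ∀ v : V, {x : V | x < v ∧ ∃ y, G.Adj v y ∧ G.Adj x y ∧ v < y}.ncard ≤ k)
    (hN : ∀ u, u < v → G.Adj v u → (N u).ncard ≤ m) :
    {x | ∃ u, u < v ∧ G.Adj v u ∧ x ∈ N u}.ncard ≤ (k + 1) * m := by
  classical
  have := Fintype.ofFinite V
  have hlow := ncard_lower_neighbors_le h v
  have hsub : {x | ∃ u, u < v ∧ G.Adj v u ∧ x ∈ N u} ⊆
      ((({u | u < v ∧ G.Adj v u} : Set V).toFinset.biUnion fun u => (N u).toFinset : Finset V) :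
        Set V) := by
    rintro x ⟨u, hu, huv, hx⟩
    simp only [coe_biUnion, Set.mem_iUnion, mem_coe, Set.mem_toFinset]
    exact ⟨u, ⟨hu, huv⟩, hx⟩
  refine (Set.ncard_le_ncard hsub (Set.toFinite _)).trans ?_
  rw [Set.ncard_coe_finset]
  refine (card_biUnion_le_card_mul _ _ m fun u hu => ?_).trans ?_
  · rw [Set.mem_toFinset] at hu
    have h2 := hN u hu.1 hu.2
    rwa [Set.ncard_eq_toFinset_card'] at h2
  · rw [Set.ncard_eq_toFinset_card'] at hlow
    exact Nat.mul_le_mul_right m hlow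

end Greedy

theorem Arrangeable.starChoosable {V : Type u} [Finite V] {G : SimpleGraph V} {k : ℕ}
    (h : Arrangeable G k) : StarChoosable G (k + 1 + (k + 1) * (k + 1) + k + 1) := by
  classical
  obtain ⟨_, h⟩ := h
  intro L hL
  -- The conflicts of `v` are its lower neighbors, their lower neighbors, and the vertices counted
  -- by the arrangeability.
  have hR : ∀ v, {x | x < v ∧ (G.Adj v x ∨ (∃ u, u < v ∧ G.Adj v u ∧ x < u ∧ G.Adj u x) ∨
      ∃ y, G.Adj v y ∧ G.Adj x y ∧ v < y)}.ncard <
      k + 1 + (k + 1) * (k + 1) + k + 1 := by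
    intro v
    have h1 := ncard_lower_neighbors_le h v
    have h2 := ncard_lower_union_le (fun u => {x | x < u ∧ G.Adj u x}) (k + 1) v h
      fun u _ _ => ncard_lower_neighbors_le h u
    have h3 := h v
    have hsub : {x | x < v ∧ (G.Adj v x ∨ (∃ u, u < v ∧ G.Adj v u ∧ x < u ∧ G.Adj u x) ∨
        ∃ y, G.Adj v y ∧ G.Adj x y ∧ v < y)} ⊆
        ({x | x < v ∧ G.Adj v x} ∪ {x | ∃ u, u < v ∧ G.Adj v u ∧ x ∈ {x | x < u ∧ G.Adj u x}}) ∪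
          {x : V | x < v ∧ ∃ y, G.Adj v y ∧ G.Adj x y ∧ v < y} := by
      rintro x ⟨hx, hx' | hx' | hx'⟩
      · exact Or.inl (Or.inl ⟨hx, hx'⟩)
      · exact Or.inl (Or.inr hx')
      · exact Or.inr ⟨hx, hx'⟩
    have h4 := Set.ncard_le_ncard hsub (Set.toFinite _)
    have h5 := Set.ncard_union_le
      ({x | x < v ∧ G.Adj v x} ∪ {x | ∃ u, u < v ∧ G.Adj v u ∧ x ∈ {x | x < u ∧ G.Adj u x}})
      {x : V | x < v ∧ ∃ y, G.Adj v y ∧ G.Adj x y ∧ v < y}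
    have h6 := Set.ncard_union_le {x | x < v ∧ G.Adj v x}
      {x | ∃ u, u < v ∧ G.Adj v u ∧ x ∈ {x | x < u ∧ G.Adj u x}}
    omega
  obtain ⟨c, hcL, hc⟩ := exists_greedy_coloring _ _ hR L hL
  -- Two neighbors of `b` with the same color both lie above `b`. On a bicolored path `p r s t` this
  -- yields both `r < s` and `s < r`.
  have hc2 : ∀ b x y, x ≠ y → G.Adj b x → G.Adj b y → c x = c y → b < x := by
    intro b x y hxy hx hy e
    by_contra hb
    have hb : x < b := lt_of_le_of_ne (not_lt.1 hb) hx.ne.symm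
    rcases lt_or_gt_of_ne hxy with h1 | h1
    · rcases lt_or_gt_of_ne hy.ne with h2 | h2
      · exact hc y x h1 (Or.inr (Or.inl ⟨b, h2, hy.symm, hb, hx⟩)) e.symm
      · exact hc y x h1 (Or.inr (Or.inr ⟨b, hy.symm, hx.symm, h2⟩)) e.symm
    · exact hc x y h1 (Or.inr (Or.inr ⟨b, hx.symm, hy.symm, hb⟩)) e
  refine ⟨c, hcL, isStarColoring_of_no_bicolored_path ?_ ?_⟩
  · intro x y hxy e
    rcases lt_or_gt_of_ne hxy.ne with h1 | h1
    · exact hc y x h1 (Or.inl hxy.symm) e.symm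
    · exact hc x y h1 (Or.inl hxy) e
  · intro p r s t hpr hrs hst hps hrt e1 e2
    have h1 := hc2 r s p hps.symm hrs hpr.symm e1.symm
    have h2 := hc2 s r t hrt hrs.symm hst e2
    exact lt_asymm h1 h2

theorem NbrSystem.ncard_le_rho {V : Type u} [Finite V] {G : SimpleGraph V} (S : NbrSystem G)
    (v : V) : (S.nbr v).ncard ≤ S.rho :=
  le_ciSup (f := fun v => (S.nbr v).ncard) (Set.finite_range _).bddAbove v

theorem Arrangeable.choosable {V : Type u} [Finite V] {G : SimpleGraph V} {k : ℕ}
    (h : Arrangeable G k) (S : NbrSystem G) : S.Choosable (k + (k + 1) * S.rho + 1) := by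
  classical
  obtain ⟨_, h⟩ := h
  intro L hL
  -- A conflict arises from a set of some `u`: either `u` is one of at most `k + 1` lower neighbors
  -- of `v`, or `u` is above `v` and arrangeability applies.
  have hR : ∀ v, {x | x < v ∧ (∃ u, v ∈ S.nbr u ∧ x ∈ S.nbr u)}.ncard <
      k + (k + 1) * S.rho + 1 := by
    intro v
    have h2 := ncard_lower_union_le S.nbr S.rho v h fun u _ _ => S.ncard_le_rho u
    have h3 := h v
    have hsub : {x | x < v ∧ ∃ u, v ∈ S.nbr u ∧ x ∈ S.nbr u} ⊆
        {x | ∃ u, u < v ∧ G.Adj v u ∧ x ∈ S.nbr u} ∪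
          {x : V | x < v ∧ ∃ y, G.Adj v y ∧ G.Adj x y ∧ v < y} := by
      rintro x ⟨hx, u, hvu, hxu⟩
      have hv : G.Adj u v := S.subset_neighborSet u hvu
      have hxu' : G.Adj u x := S.subset_neighborSet u hxu
      rcases lt_or_gt_of_ne hv.ne with h1 | h1
      · exact Or.inl ⟨u, h1, hv.symm, hxu⟩
      · exact Or.inr ⟨hx, u, hv.symm, hxu'.symm, h1⟩
    have h4 := Set.ncard_le_ncard hsub (Set.toFinite _)
    have h5 := Set.ncard_union_le {x | ∃ u, u < v ∧ G.Adj v u ∧ x ∈ S.nbr u}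
      {x : V | x < v ∧ ∃ y, G.Adj v y ∧ G.Adj x y ∧ v < y}
    omega
  obtain ⟨c, hcL, hc⟩ := exists_greedy_coloring _ _ hR L hL
  refine ⟨c, hcL, fun w x hx y hy hxy e => ?_⟩
  rcases lt_or_gt_of_ne hxy with h1 | h1
  · exact hc y x h1 ⟨w, hy, hx⟩ e.symm
  · exact hc x y h1 ⟨w, hx, hy⟩ e

/-! ### Degeneracy of pair graphs -/

section Degenerate

/-- Each non-empty finite set `U` has a vertex with fewer than `d` neighbors in `U`. -/
def IsDegenerate {V : Type u} (R : V → V → Prop) (d : ℕ) : Prop :=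
  ∀ U : Finset V, U.Nonempty → ∃ v ∈ U, ∀ N : Finset V, N ⊆ U → (∀ u ∈ N, R v u) → #N < d

/-- The graph whose edges are the pairs `p w`, for `w ∈ W`. -/
def PairAdj {V : Type u} (W : Finset V) (p : V → Sym2 V) (x y : V) : Prop :=
  x ≠ y ∧ ∃ w ∈ W, p w = s(x, y)

/-- All graphs obtained by choosing at most one pair of neighbors of each vertex are degenerate. -/
def PairDegenerate {V : Type u} (G : SimpleGraph V) (d : ℕ) : Prop :=
  ∀ (W : Finset V) (p : V → Sym2 V), (∀ w ∈ W, ∀ x ∈ p w, G.Adj w x) →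
    IsDegenerate (PairAdj W p) d

theorem PairAdj.symm {V : Type u} {W : Finset V} {p : V → Sym2 V} {x y : V}
    (h : PairAdj W p x y) : PairAdj W p y x := by
  obtain ⟨hne, w, hw, hp⟩ := h
  exact ⟨hne.symm, w, hw, hp.trans Sym2.eq_swap⟩

theorem exists_large_neighborhoods {V : Type u} {R : V → V → Prop} {d : ℕ}
    (h : ¬ IsDegenerate R d) : ∃ (U : Finset V) (N : V → Finset V), U.Nonempty ∧
      (∀ v ∈ U, d ≤ #(N v) ∧ N v ⊆ U) ∧ ∀ v ∈ U, ∀ u ∈ N v, R v u := by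
  unfold IsDegenerate at h
  push Not at h
  obtain ⟨U, hU, h⟩ := h
  choose! N hN using h
  exact ⟨U, N, hU, fun v hv => ⟨(hN v hv).2.2, (hN v hv).1⟩, fun v hv => (hN v hv).2.1⟩

/-- Deleting a vertex with fewer than `d` neighbors lowers the degree sum by less than `2 * d`. -/
theorem IsDegenerate.sum_card_le {V : Type u} [DecidableEq V] {R : V → V → Prop} [DecidableRel R]
    {d : ℕ} (h : IsDegenerate R d) (hsymm : ∀ x y, R x y → R y x) (X : Finset V) :
    ∑ v ∈ X, #{u ∈ X | R v u} ≤ 2 * d * #X := by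
  induction X using Finset.strongInduction with
  | _ X ih =>
    rcases X.eq_empty_or_nonempty with rfl | hX
    · simp
    obtain ⟨v₀, hv₀, hdeg⟩ := h X hX
    have h0 : #{u ∈ X | R v₀ u} < d :=
      hdeg _ (filter_subset _ _) fun u hu => (mem_filter.1 hu).2
    have h1 := ih (X.erase v₀) (erase_ssubset hv₀)
    have h2 : ∀ v ∈ X.erase v₀, #{u ∈ X | R v u} ≤
        #{u ∈ X.erase v₀ | R v u} + if R v v₀ then 1 else 0 := by
      intro v _
      conv_lhs => rw [← insert_erase hv₀, filter_insert]
      split_ifs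
      · exact card_insert_le _ _
      · exact le_rfl
    have h3 : ∑ v ∈ X.erase v₀, (if R v v₀ then 1 else 0) ≤ #{u ∈ X | R v₀ u} := by
      rw [← card_filter]
      refine card_le_card fun u hu => ?_
      obtain ⟨hu, hR⟩ := mem_filter.1 hu
      exact mem_filter.2 ⟨mem_of_mem_erase hu, hsymm _ _ hR⟩
    have h4 := sum_le_sum h2
    rw [sum_add_distrib] at h4
    rw [← add_sum_erase X _ hv₀]
    have h5 : #X = #(X.erase v₀) + 1 := (card_erase_add_one hv₀).symm
    rw [h5, mul_add]
    omega

theorem exists_pairDegenerate_of_starChoosable (k : ℕ) (hk : 0 < k) :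
    ∃ d : ℕ, ∀ {V : Type u} [Finite V] (G : SimpleGraph V), StarChoosable G k →
      PairDegenerate G d := by
  classical
  obtain ⟨d, -, hd⟩ := exists_lists_of_large_degree.{u} k (2 * k) hk
  refine ⟨d, fun {V} _ G hG W p hWp => ?_⟩
  by_contra hcon
  have := Fintype.ofFinite V
  obtain ⟨U, N, hU, hN, hadj⟩ := exists_large_neighborhoods hcon
  obtain ⟨L, hL, hbad⟩ := hd N U hU hN
  obtain ⟨c, hc, hstar⟩ := hG L fun v => (hL v).2.ge
  -- More than `2 * k` pair-neighbors share the color of `v`, while the middle vertices use at most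
  -- `2 * k` colors. Two middle vertices thus agree, and `w y`, `v`, `w x`, `x` is a bicolored path.
  obtain ⟨v, hv, hlt⟩ := hbad c hc
  choose! hne w hw hp using hadj v hv
  obtain ⟨x, hx, y, hy, hxy, e⟩ := exists_ne_map_eq_of_card_lt_of_maps_to
    (s := {u ∈ N v | c u = c v}) (t := range (2 * k)) (f := fun u => c (w u))
    (by rwa [card_range]) fun u _ => (hL (w u)).1 (hc (w u))
  obtain ⟨hx, hcx⟩ := mem_filter.1 hx
  obtain ⟨hy, -⟩ := mem_filter.1 hy
  refine hstar.no_bicolored_path (p := w y) (r := v) (s := w x) (t := x) ?_ ?_ ?_ ?_ (hne x hx)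
    e.symm hcx.symm
  · exact hWp _ (hw y hy) v (by rw [hp y hy]; exact Sym2.mem_mk_left _ _)
  · exact (hWp _ (hw x hx) v (by rw [hp x hx]; exact Sym2.mem_mk_left _ _)).symm
  · exact hWp _ (hw x hx) x (by rw [hp x hx]; exact Sym2.mem_mk_right _ _)
  · intro h
    have h' := (hp x hx).symm.trans ((congrArg p h.symm).trans (hp y hy))
    exact hxy (Sym2.congr_right.1 h')

theorem exists_pairDegenerate_of_choosable (k : ℕ) (hk : 0 < k) :
    ∃ d : ℕ, ∀ {V : Type u} [Finite V] (G : SimpleGraph V),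
      (∀ S : NbrSystem G, S.rho = 2 → S.Choosable k) → PairDegenerate G d := by
  classical
  obtain ⟨d, hdpos, hd⟩ := exists_lists_of_large_degree.{u} k 0 hk
  refine ⟨d, fun {V} _ G hG W p hWp => ?_⟩
  by_contra hcon
  have := Fintype.ofFinite V
  obtain ⟨U, N, hU, hN, hadj⟩ := exists_large_neighborhoods hcon
  let S : NbrSystem G := ⟨fun w => {x | w ∈ W ∧ x ∈ p w}, fun w x hx => hWp w hx.1 x hx.2⟩
  have hset : ∀ w ∈ W, ∀ x y, p w = s(x, y) → S.nbr w = {x, y} := by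
    intro w hw x y h
    ext z
    change (w ∈ W ∧ z ∈ p w) ↔ _
    simp [hw, h]
  have hrho : S.rho = 2 := by
    obtain ⟨v, hv⟩ := hU
    have : Nonempty V := ⟨v⟩
    apply le_antisymm
    · refine ciSup_le fun w => ?_
      by_cases hw : w ∈ W
      · obtain ⟨x, y, hxy⟩ : ∃ x y, p w = s(x, y) := by
          induction p w with | _ x y => exact ⟨x, y, rfl⟩
        rw [hset w hw x y hxy]
        exact (Set.ncard_insert_le _ _).trans (by simp)
      · have h0 : S.nbr w = ∅ := Set.eq_empty_of_forall_notMem fun x hx => hw hx.1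
        simp [h0]
    -- Since `0 < d`, some pair is an edge, so the value 2 is attained.
    · obtain ⟨u, hu⟩ := card_pos.1 (hdpos.trans_le (hN v hv).1)
      obtain ⟨hne, w, hw, hp⟩ := hadj v hv u hu
      have h := S.ncard_le_rho w
      rwa [hset w hw v u hp, Set.ncard_pair hne] at h
  obtain ⟨L, hL, hbad⟩ := hd N U hU hN
  obtain ⟨c, hc, hcol⟩ := hG S hrho L fun v => (hL v).2.ge
  obtain ⟨v, hv, hlt⟩ := hbad c hc
  obtain ⟨u, hu⟩ := card_pos.1 hlt
  obtain ⟨hu, e⟩ := mem_filter.1 hu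
  obtain ⟨hne, w, hw, hp⟩ := hadj v hv u hu
  have hS := hset w hw v u hp
  exact hcol w v (by simp [hS]) u (by simp [hS]) hne e.symm

/-- Choosing distinct pairs of neighbors greedily: all pairs of neighbors of an unused vertex are
chosen. -/
theorem exists_saturated_pairs {V : Type u} (G : SimpleGraph V) (X Y : Finset V) :
    ∃ (W : Finset V) (p : V → Sym2 V), W ⊆ Y ∧ (∀ w ∈ W, ∀ x ∈ p w, G.Adj w x ∧ x ∈ X) ∧
      Set.InjOn p W ∧ (∀ w ∈ W, ¬ (p w).IsDiag) ∧
        ∀ y ∈ Y, y ∉ W → ∀ x ∈ X, ∀ z ∈ X, G.Adj y x → G.Adj y z → x ≠ z → PairAdj W p x z := by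
  classical
  induction Y using Finset.induction_on with
  | empty => exact ⟨∅, fun v => s(v, v), by simp⟩
  | insert y Y hy ih =>
    obtain ⟨W, p, hWY, hadj, hinj, hdiag, hsat⟩ := ih
    -- If all pairs at `y` are already chosen, `y` stays unused; otherwise it takes a new one.
    by_cases h : ∀ x ∈ X, ∀ z ∈ X, G.Adj y x → G.Adj y z → x ≠ z → PairAdj W p x z
    · refine ⟨W, p, hWY.trans (subset_insert _ _), hadj, hinj, hdiag, fun y' hy' hW => ?_⟩
      rcases mem_insert.1 hy' with rfl | hy'
      · exact h
      · exact hsat y' hy' hW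
    · push Not at h
      obtain ⟨x, hx, z, hz, hyx, hyz, hxz, hnew⟩ := h
      have hyW : y ∉ W := fun h => hy (hWY h)
      have hold : ∀ w ∈ W, Function.update p y s(x, z) w = p w := fun w hw =>
        Function.update_of_ne (ne_of_mem_of_not_mem hw hyW) _ _
      have hne : ∀ w ∈ W, p w ≠ s(x, z) := fun w hw e => hnew ⟨hxz, w, hw, e⟩
      refine ⟨insert y W, Function.update p y s(x, z), insert_subset_insert _ hWY, ?_, ?_, ?_, ?_⟩
      · intro w hw v hv
        rcases mem_insert.1 hw with rfl | hw
        · rw [Function.update_self, Sym2.mem_iff] at hv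
          rcases hv with rfl | rfl
          · exact ⟨hyx, hx⟩
          · exact ⟨hyz, hz⟩
        · rw [hold w hw] at hv
          exact hadj w hw v hv
      · rw [coe_insert, Set.injOn_insert hyW]
        refine ⟨fun a ha b hb e => hinj ha hb ?_, ?_⟩
        · rwa [hold a ha, hold b hb] at e
        · rintro ⟨w, hw, e⟩
          rw [hold w hw, Function.update_self] at e
          exact hne w hw e
      · intro w hw
        rcases mem_insert.1 hw with rfl | hw
        · rwa [Function.update_self, Sym2.mk_isDiag_iff]
        · rw [hold w hw]
          exact hdiag w hw
      · intro y' hy' hW a ha b hb hya hyb hab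
        have hW' := fun h => hW (mem_insert_of_mem h)
        rcases mem_insert.1 hy' with rfl | hy'
        · exact (hW (mem_insert_self _ _)).elim
        · obtain ⟨_, w, hw, hp⟩ := hsat y' hy' hW' a ha b hb hya hyb hab
          exact ⟨hab, w, mem_insert_of_mem hw, (hold w hw).trans hp⟩

/-- Orienting each pair by `out` injects `W` into the incidences counted by the degree sum on `X`.
-/
theorem card_le_of_pairs_injOn {V : Type u} {W X : Finset V} {p : V → Sym2 V} {d : ℕ}
    (hX : ∀ w ∈ W, ∀ x ∈ p w, x ∈ X) (hinj : Set.InjOn p W) (hdiag : ∀ w ∈ W, ¬ (p w).IsDiag)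
    (hdeg : IsDegenerate (PairAdj W p) d) : #W ≤ 2 * d * #X := by
  classical
  refine le_trans ?_ (hdeg.sum_card_le (fun _ _ => PairAdj.symm) X)
  rw [← card_sigma]
  have hout : ∀ w, s((p w).out.1, (p w).out.2) = p w := fun w => Quot.out_eq _
  refine card_le_card_of_injOn (fun w => ⟨(p w).out.1, (p w).out.2⟩) (fun w hw => ?_)
    fun a ha b hb e => hinj ha hb ?_
  · have h1 : (p w).out.1 ∈ p w := Sym2.mem_iff_exists.2 ⟨_, (hout w).symm⟩
    have h2 : (p w).out.2 ∈ p w :=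
      Sym2.mem_iff_exists.2 ⟨_, (hout w).symm.trans Sym2.eq_swap⟩
    refine mem_sigma.2 ⟨hX w hw _ h1, mem_filter.2 ⟨hX w hw _ h2, fun e => hdiag w hw ?_, w, hw,
      (hout w).symm⟩⟩
    rw [← hout w, Sym2.mk_isDiag_iff]
    exact e
  · simp only [Sigma.mk.injEq, heq_eq_eq] at e
    rw [← hout a, ← hout b, e.1, e.2]

/-! ### From pair degeneracy to an arrangement -/

/-- In a subgraph of large minimum degree, take `A` and a much larger `B` whose vertices each have
`d + 1` neighbors in `A`. A saturated choice of pairs in `A` uses at most `2 * d * #A < #B` vertices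
of `B`; the neighbors in `A` of an unused one form a clique of the pair graph, too large for its
degeneracy. -/
theorem exists_isDegenerate_of_pairDegenerate (d : ℕ) :
    ∃ D : ℕ, ∀ {V : Type u} [Finite V] (G : SimpleGraph V), PairDegenerate G d →
      IsDegenerate G.Adj D := by
  classical
  obtain ⟨D, hD⟩ := exists_unbalanced_pair.{u} (Fin (d + 1)) (2 * d + 1)
  refine ⟨D, fun {V} _ G hG => ?_⟩
  by_contra hcon
  have := Fintype.ofFinite V
  obtain ⟨U, N, hU, hN, hadj⟩ := exists_large_neighborhoods hcon
  obtain ⟨A, B, χ, -, hBU, -, ⟨b₀, hb₀⟩, hAB, hsee⟩ := hD N U hU hN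
  obtain ⟨W, p, hWB, hp, hinj, hdiag, hsat⟩ := exists_saturated_pairs G A B
  have hdeg := hG W p fun w hw x hx => (hp w hw x hx).1
  have hW := card_le_of_pairs_injOn (fun w hw x hx => (hp w hw x hx).2) hinj hdiag hdeg
  obtain ⟨a, -, ha, -⟩ := hsee b₀ hb₀ 0
  have hA : 0 < #A := card_pos.2 ⟨a, ha⟩
  obtain ⟨b, hb, hbW⟩ := exists_mem_notMem_of_card_lt_card (show #W < #B by
    rw [add_mul] at hAB
    omega)
  choose f hfN hfA hf using hsee b hb
  have hfinj : Function.Injective f := fun i j e => by rw [← hf i, e, hf j]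
  set K : Finset V := {u ∈ A | G.Adj b u} with hK
  have hKcard : d + 1 ≤ #K := by
    have h := card_le_card_of_injOn (s := univ) (t := K) f
      (fun i _ => mem_filter.2 ⟨hfA i, hadj b (hBU hb) _ (hfN i)⟩) hfinj.injOn
    simpa using h
  obtain ⟨v, hv, hvK⟩ := hdeg K (card_pos.1 (by omega))
  have h := hvK (K.erase v) (erase_subset _ _) fun u hu => by
    obtain ⟨hne, hu⟩ := mem_erase.1 hu
    have hv' := mem_filter.1 hv
    have hu' := mem_filter.1 hu
    exact hsat b hb hbW v hv'.1 u hu'.1 hv'.2 hu'.2 hne.symm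
  rw [card_erase_of_mem hv] at h
  omega

/-- `X` holds the vertices not yet placed; those outside are above it. The bound on the degree of
`v` in `X` preserves the hypothesis `hY` when `v` leaves `X`, and the second bound is the
arrangeability condition at `v`. -/
theorem exists_next_vertex {V : Type u} [Finite V] {G : SimpleGraph V} {d e : ℕ}
    (hd : PairDegenerate G d) (he : IsDegenerate G.Adj e) (X : Finset V) (hX : X.Nonempty)
    (hY : ∀ y ∉ X, {x | x ∈ X ∧ G.Adj y x}.ncard ≤ 4 * e) :
    ∃ v ∈ X, {x | x ∈ X ∧ G.Adj v x}.ncard ≤ 4 * e ∧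
      {x | x ∈ X ∧ x ≠ v ∧ ∃ y ∉ X, G.Adj v y ∧ G.Adj x y}.ncard ≤
        2 * (2 * d + 2 * d * (4 * e) * (4 * e)) := by
  classical
  have := Fintype.ofFinite V
  have hconv : ∀ Q : V → Prop, {x | x ∈ X ∧ Q x}.ncard = #{x ∈ X | Q x} := by
    intro Q
    rw [← Set.ncard_coe_finset, coe_filter]
  simp only [hconv] at hY ⊢
  set D := 4 * e with hD
  set S := 2 * d + 2 * d * D * D with hS
  obtain ⟨W, p, hWB, hp, hinj, hdiag, hsat⟩ := exists_saturated_pairs G X Xᶜ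
  have hdeg := hd W p fun w hw x hx => (hp w hw x hx).1
  have hW := card_le_of_pairs_injOn (fun w hw x hx => (hp w hw x hx).2) hinj hdiag hdeg
  have h1 := he.sum_card_le (fun _ _ h => h.symm) X
  have h2 := hdeg.sum_card_le (fun _ _ => PairAdj.symm) X
  -- A common neighbor outside `W` makes `v` and `x` adjacent in the pair graph, contributing at
  -- most `2 * d * #X`. Each of the at most `2 * d * #X` vertices of `W` contributes at most `D *
  -- D`.
  have h3 : ∑ v ∈ X, #{x ∈ X | x ≠ v ∧ ∃ y ∉ X, G.Adj v y ∧ G.Adj x y} ≤ S * #X := by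
    have hone : ∀ v ∈ X, #{x ∈ X | x ≠ v ∧ ∃ y ∉ X, G.Adj v y ∧ G.Adj x y} ≤
        #{x ∈ X | PairAdj W p v x} + ∑ w ∈ W, if G.Adj w v then D else 0 := by
      intro v hv
      have hsub : ({x ∈ X | x ≠ v ∧ ∃ y ∉ X, G.Adj v y ∧ G.Adj x y} : Finset V) ⊆
          {x ∈ X | PairAdj W p v x} ∪
            ({w ∈ W | G.Adj w v} : Finset V).biUnion fun w => {x ∈ X | G.Adj w x} := by
        intro x hx
        obtain ⟨hxX, hne, y, hy, hvy, hxy⟩ := mem_filter.1 hx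
        by_cases hyW : y ∈ W
        · exact mem_union_right _ (mem_biUnion.2 ⟨y, mem_filter.2 ⟨hyW, hvy.symm⟩,
            mem_filter.2 ⟨hxX, hxy.symm⟩⟩)
        · exact mem_union_left _ (mem_filter.2 ⟨hxX, hsat y (mem_compl.2 hy) hyW v hv x hxX
            hvy.symm hxy.symm hne.symm⟩)
      refine (card_le_card hsub).trans ((card_union_le _ _).trans (Nat.add_le_add_left ?_ _))
      rw [← sum_filter]
      refine card_biUnion_le.trans (sum_le_sum fun w hw => ?_)
      exact hY w (mem_compl.1 (hWB (mem_filter.1 hw).1))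
    have hsum := sum_le_sum hone
    rw [sum_add_distrib, sum_comm] at hsum
    have hin : ∀ w ∈ W, (∑ v ∈ X, if G.Adj w v then D else 0) ≤ D * D := by
      intro w hw
      rw [← sum_filter, sum_const, smul_eq_mul]
      exact Nat.mul_le_mul_right _ (hY w (mem_compl.1 (hWB hw)))
    have h4 := sum_le_card_nsmul _ _ _ hin
    rw [smul_eq_mul] at h4
    have h5 := Nat.mul_le_mul_right (D * D) hW
    have h6 : S * #X = 2 * d * #X + 2 * d * #X * (D * D) := by rw [hS]; ring
    omega
  by_contra! hcon
  -- Markov's inequality for both bounds at once: the averages are at most `2 * e` and `S`, and each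
  -- `v` would exceed twice one of them. The weights make either failure cost the same.
  have h4 : ∀ v ∈ X, (D + 1) * (2 * S + 1) ≤ (2 * S + 1) * #{x ∈ X | G.Adj v x} +
      (D + 1) * #{x ∈ X | x ≠ v ∧ ∃ y ∉ X, G.Adj v y ∧ G.Adj x y} := by
    intro v hv
    by_cases h : #{x ∈ X | G.Adj v x} ≤ D
    · refine le_add_left (Nat.mul_le_mul_left _ ?_)
      convert Nat.succ_le_of_lt (hcon v hv h)
    · rw [mul_comm]
      exact le_add_right (Nat.mul_le_mul_left _ (not_le.1 h))
  have h5 := sum_le_sum h4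
  rw [sum_const, smul_eq_mul, sum_add_distrib, ← mul_sum, ← mul_sum] at h5
  have h6 := h5.trans (Nat.add_le_add (Nat.mul_le_mul_left _ h1) (Nat.mul_le_mul_left _ h3))
  have h7 : #X * ((D + 1) * (2 * S + 1)) ≤ #X * ((2 * S + 1) * (2 * e) + (D + 1) * S) :=
    h6.trans (le_of_eq (by ring))
  have h8 := Nat.le_of_mul_le_mul_left h7 hX.card_pos
  rw [hD] at h8
  nlinarith

theorem exists_arrangement {V : Type u} [Finite V] {G : SimpleGraph V} {d e : ℕ}
    (hd : PairDegenerate G d) (he : IsDegenerate G.Adj e) (X : Finset V)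
    (hY : ∀ y ∉ X, {x | x ∈ X ∧ G.Adj y x}.ncard ≤ 4 * e) :
    ∃ f : V → ℕ, Set.InjOn f X ∧ ∀ v ∈ X,
      {x | x ∈ X ∧ f x < f v ∧ ∃ y, G.Adj v y ∧ G.Adj x y ∧ (y ∉ X ∨ f v < f y)}.ncard ≤
        2 * (2 * d + 2 * d * (4 * e) * (4 * e)) := by
  classical
  induction X using Finset.strongInduction with
  | _ X ih =>
    rcases X.eq_empty_or_nonempty with rfl | hX
    · exact ⟨fun _ => 0, by simp⟩
    obtain ⟨v₀, hv₀, hdeg, hsq⟩ := exists_next_vertex hd he X hX hY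
    obtain ⟨f, hinj, hf⟩ := ih (X.erase v₀) (erase_ssubset hv₀) (by
      intro y hy
      refine (Set.ncard_le_ncard (t := {x | x ∈ X ∧ G.Adj y x}) ?_ (Set.toFinite _)).trans ?_
      · exact fun x hx => ⟨mem_of_mem_erase hx.1, hx.2⟩
      · by_cases h : y = v₀
        · rw [h]
          exact hdeg
        · exact hY y fun hyX => hy (mem_erase.2 ⟨h, hyX⟩))
    -- `v₀` goes on top of the rest of `X`, so the common neighbors above it lie outside `X`; for
    -- the other vertices, `v₀` itself counts as outside.
    set g := Function.update f v₀ ((X.erase v₀).sup f + 1)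
    have hg : ∀ x, x ≠ v₀ → g x = f x := fun x hx => Function.update_of_ne hx _ _
    have hlt : ∀ x ∈ X, x ≠ v₀ → g x < g v₀ := by
      intro x hx hne
      rw [hg x hne, show g v₀ = _ from Function.update_self _ _ _]
      exact Nat.lt_succ_of_le (le_sup (f := f) (mem_erase.2 ⟨hne, hx⟩))
    refine ⟨g, ?_, fun v hv => ?_⟩
    · intro x hx y hy hxy
      by_cases h1 : x = v₀ <;> by_cases h2 : y = v₀
      · exact h1.trans h2.symm
      · exact absurd hxy.symm (h1 ▸ (hlt y hy h2).ne)
      · exact absurd hxy (h2 ▸ (hlt x hx h1).ne)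
      · rw [hg x h1, hg y h2] at hxy
        exact hinj (mem_coe.2 (mem_erase.2 ⟨h1, hx⟩)) (mem_coe.2 (mem_erase.2 ⟨h2, hy⟩)) hxy
    · by_cases hv' : v = v₀
      · subst hv'
        refine (Set.ncard_le_ncard ?_ (Set.toFinite _)).trans hsq
        rintro x ⟨hxX, hxv, y, hvy, hxy, hy⟩
        refine ⟨hxX, fun e => hxv.ne (congrArg g e), y, fun hyX => ?_, hvy, hxy⟩
        exact (hy.resolve_left (not_not.2 hyX)).not_gt (hlt y hyX hvy.ne.symm)
      · refine (Set.ncard_le_ncard ?_ (Set.toFinite _)).trans (hf v (mem_erase.2 ⟨hv', hv⟩))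
        rintro x ⟨hxX, hxv, y, hvy, hxy, hy⟩
        have hx : x ≠ v₀ := fun e => hxv.not_gt (e ▸ hlt v hv hv')
        rw [hg x hx, hg v hv'] at hxv
        refine ⟨mem_erase.2 ⟨hx, hxX⟩, hxv, y, hvy, hxy, ?_⟩
        by_cases hy' : y = v₀
        · exact Or.inl (hy' ▸ notMem_erase _ _)
        · rw [hg y hy', hg v hv'] at hy
          exact hy.imp_left fun h h' => h (mem_of_mem_erase h')

theorem exists_arrangeable_of_pairDegenerate (d : ℕ) :
    ∃ K : ℕ, ∀ {V : Type u} [Finite V] (G : SimpleGraph V), PairDegenerate G d →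
      Arrangeable G K := by
  obtain ⟨e, he⟩ := exists_isDegenerate_of_pairDegenerate.{u} d
  refine ⟨2 * (2 * d + 2 * d * (4 * e) * (4 * e)), fun {V} _ G hG => ?_⟩
  have := Fintype.ofFinite V
  obtain ⟨f, hinj, hf⟩ := exists_arrangement hG (he G hG) univ (by simp)
  have hf' : Function.Injective f := by
    rwa [coe_univ, Set.injOn_univ] at hinj
  refine ⟨LinearOrder.lift' f hf', fun v => ?_⟩
  refine (Set.ncard_le_ncard ?_ (Set.toFinite _)).trans (hf v (mem_univ v))
  rintro x ⟨hxv, y, hvy, hxy, hlt⟩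
  exact ⟨mem_univ _, hxv, y, hvy, hxy, Or.inr hlt⟩

end Degenerate

/-! ### From least values to choosability and arrangeability -/

section LeastValues

variable {V : Type u} [Finite V] {G : SimpleGraph V} {k : ℕ}

theorem starChoosable_of_starChoiceNumber_le (h : starChoiceNumber G ≤ k) : StarChoosable G k :=
  have hmin : StarChoosable G (starChoiceNumber G) :=
    Nat.sInf_mem (s := {k | StarChoosable G k}) ⟨_, starChoosable_card G⟩
  fun L hL => hmin L fun v => h.trans (hL v)

theorem NbrSystem.choosable_of_ch_le {S : NbrSystem G} (h : S.ch ≤ k) : S.Choosable k :=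
  have hmin : S.Choosable S.ch := Nat.sInf_mem (s := {k | S.Choosable k}) ⟨_, S.choosable_card⟩
  fun L hL => hmin L fun v => h.trans (hL v)

theorem arrangeable_of_arrangeability_le (h : arrangeability G ≤ k) : Arrangeable G k := by
  have hmin : Arrangeable G (arrangeability G) :=
    Nat.sInf_mem (s := {k | Arrangeable G k}) ⟨_, arrangeable_card G⟩
  obtain ⟨o, ho⟩ := hmin
  exact ⟨o, fun v => (ho v).trans h⟩

theorem NbrSystem.one_le_rho {S : NbrSystem G} (h : S.Nonempty) : 1 ≤ S.rho := by
  obtain ⟨v, hv⟩ := h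
  exact ((Set.ncard_pos (Set.toFinite _)).2 hv).trans_le (S.ncard_le_rho v)

end LeastValues

theorem NbrSystem.ch_le_one {V : Type u} {G : SimpleGraph V} {S : NbrSystem G} (h : ¬ S.Nonempty) : S.ch ≤ 1 := by
  refine Nat.sInf_le fun L hL => ?_
  choose c hc using fun v => card_pos.1 (hL v)
  exact ⟨c, hc, fun w x hx => (h ⟨w, x, hx⟩).elim⟩

end SigmaColoring

/-! ### The equivalences -/

theorem theorem3 (F : Set SigmaColoring.FinGraph.{u}) :
    List.TFAE [
      -- bounded star choice number
      ∃ k : ℕ, ∀ G ∈ F, SigmaColoring.starChoiceNumber G.graph ≤ k,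
      -- bounded arrangeability
      ∃ k : ℕ, ∀ G ∈ F, SigmaColoring.arrangeability G.graph ≤ k,
      -- linear bound for the choice number of neighborhood systems
      ∃ C : ℝ, ∀ G ∈ F, ∀ S : SigmaColoring.NbrSystem G.graph, S.Nonempty →
        (S.ch : ℝ) ≤ C * (S.rho : ℝ),
      -- functional bound
      ∃ f : ℕ → ℝ, ∀ G ∈ F, ∀ S : SigmaColoring.NbrSystem G.graph, (S.ch : ℝ) ≤ f S.rho,
      -- bound for systems whose largest set has size two
      BddAbove {n : ℕ | ∃ G ∈ F, ∃ S : SigmaColoring.NbrSystem G.graph,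
        S.rho = 2 ∧ S.ch = n}] := by
  tfae_have 1 → 2 := by
    rintro ⟨k, hk⟩
    obtain ⟨d, hd⟩ := SigmaColoring.exists_pairDegenerate_of_starChoosable.{u} (k + 1) k.succ_pos
    obtain ⟨K, hK⟩ := SigmaColoring.exists_arrangeable_of_pairDegenerate.{u} d
    exact ⟨K, fun G hG => Nat.sInf_le (hK _ (hd _
      (SigmaColoring.starChoosable_of_starChoiceNumber_le ((hk G hG).trans k.le_succ))))⟩
  tfae_have 2 → 1 := by
    rintro ⟨k, hk⟩
    exact ⟨_, fun G hG =>
      Nat.sInf_le (SigmaColoring.arrangeable_of_arrangeability_le (hk G hG)).starChoosable⟩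
  tfae_have 2 → 3 := by
    rintro ⟨k, hk⟩
    -- The additive `k + 1` is absorbed because `S.rho ≥ 1` for a non-empty system.
    refine ⟨2 * k + 2, fun G hG S hS => ?_⟩
    have h1 : S.ch ≤ k + (k + 1) * S.rho + 1 :=
      Nat.sInf_le ((SigmaColoring.arrangeable_of_arrangeability_le (hk G hG)).choosable S)
    have h2 := SigmaColoring.NbrSystem.one_le_rho hS
    have h3 : S.ch ≤ (2 * k + 2) * S.rho := by nlinarith
    exact_mod_cast h3
  tfae_have 3 → 4 := by
    rintro ⟨C, hC⟩
    -- The summand 1 serves the empty systems; the absolute value keeps the bound at least 1 even if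
    -- `C` is negative.
    refine ⟨fun n => |C| * n + 1, fun G hG S => ?_⟩
    by_cases hS : S.Nonempty
    · have h1 := hC G hG S hS
      have h2 : C * (S.rho : ℝ) ≤ |C| * S.rho :=
        mul_le_mul_of_nonneg_right (le_abs_self C) (Nat.cast_nonneg _)
      linarith
    · have h1 : (S.ch : ℝ) ≤ 1 := by exact_mod_cast SigmaColoring.NbrSystem.ch_le_one hS
      have h2 : 0 ≤ |C| * (S.rho : ℝ) := by positivity
      linarith
  tfae_have 4 → 5 := by
    rintro ⟨f, hf⟩
    refine ⟨⌈f 2⌉₊, ?_⟩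
    rintro n ⟨G, hG, S, hS, rfl⟩
    have h := hf G hG S
    rw [hS] at h
    exact_mod_cast h.trans (Nat.le_ceil _)
  tfae_have 5 → 2 := by
    rintro ⟨k, hk⟩
    obtain ⟨d, hd⟩ :=
      SigmaColoring.exists_pairDegenerate_of_choosable.{u} (k + 1) k.succ_pos
    obtain ⟨K, hK⟩ := SigmaColoring.exists_arrangeable_of_pairDegenerate.{u} d
    refine ⟨K, fun G hG => Nat.sInf_le (hK _ (hd _ fun S hS => ?_))⟩
    exact SigmaColoring.NbrSystem.choosable_of_ch_le ((hk ⟨G, hG, S, hS, rfl⟩).trans k.le_succ)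
  tfae_finish
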